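/- Let $K$ be a field; all coalgebras and comodules are over $K$ (coassociative and counital). A left (right) comodule is Artinian if it satisfies the descending chain condition on left (right) subcomodules; a coalgebra $C$ is left (right) Artinian if it is Artinian as a left (right) comodule over itself; a left (right) $C$-comodule is finitely cogenerated if it embeds, as a comodule, into $C^n$ for some positive integer $n$. Let $D,E$ be coalgebras and $M$ a $D$-$E$-bicomodule, with left coaction $m\mapsto m_{[-1]}\otimes m_{[0]}\in D\otimes M$ and right coaction $m\mapsto m_{(0)}\otimes m_{(1)}\in M\otimes E$. Let $\begin{pmatrix} D & M\\ 0& E\end{pmatrix}$ denote the upper triangular comatrix coalgebra, i.e. the space $D\oplus M\oplus E$ with $\Delta(d)=d_1\otimes d_2$, $\Delta(m)=m_{[-1]}\otimes m_{[0]}+m_{(0)}\otimes m_{(1)}$, $\Delta(e)=e_1\otimes e_2$, and counit $\varepsilon(d+m+e)=\varepsilon_D(d)+\varepsilon_E(e)$. 1. $\begin{pmatrix} D & M\\ 0& E\end{pmatrix}$ is left Artinian if and only if $D$ and $E$ are left Artinian and $M$ is finitely cogenerated as a left $D$-comodule. It is right Artinian if and only if $D$ and $E$ are right Artinian and $M$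 is finitely cogenerated as a right $E$-comodule. 2. If $D$ is an infinite dimensional left Artinian coalgebra, then $\begin{pmatrix} D & D\\ 0& K\end{pmatrix}$, where the entry $D$ in the upper right corner is the regular left $D$-comodule with right $K$-coaction $d\mapsto d\otimes 1$, is left Artinian but not right Artinian. 3. The divided power coalgebra (basis $c_0,c_1,c_2,\dots$, $\Delta(c_n)=\sum_{i+j=n}c_i\otimes c_j$, $\varepsilon(c_n)=\delta_{n,0}$) is infinite dimensional and both left and right Artinian. Hence, taking it for $D$ in part 2, one obtains over every field $K$ a coalgebra that is left Artinian but not right Artinian. -/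

import Mathlib

open scoped TensorProduct

/-- A left comodule structure on `M` over the `K`-coalgebra `D`: a coaction `M → D ⊗ M` that is
coassociative and counital. -/
structure LeftComodule (K D M : Type*) [Field K] [AddCommGroup D] [Module K D] [Coalgebra K D]
    [AddCommGroup M] [Module K M] where
  coact : M →ₗ[K] D ⊗[K] M
  coassoc : TensorProduct.assoc K D D M ∘ₗ (Coalgebra.comul (R := K) (A := D)).rTensor M ∘ₗ coact
    = coact.lTensor D ∘ₗ coact
  counit_coact : (Coalgebra.counit (R := K) (A := D)).rTensor M ∘ₗ coact = TensorProduct.mk K K M 1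

/-- A right comodule structure on `M` over the `K`-coalgebra `E`: a coaction `M → M ⊗ E` that is
coassociative and counital. -/
structure RightComodule (K M E : Type*) [Field K] [AddCommGroup M] [Module K M]
    [AddCommGroup E] [Module K E] [Coalgebra K E] where
  coact : M →ₗ[K] M ⊗[K] E
  coassoc : TensorProduct.assoc K M E E ∘ₗ coact.rTensor E ∘ₗ coact
    = (Coalgebra.comul (R := K) (A := E)).lTensor M ∘ₗ coact
  counit_coact : (Coalgebra.counit (R := K) (A := E)).lTensor M ∘ₗ coact
    = (TensorProduct.mk K M K).flip 1

/-- A `D`-`E`-bicomodule structure on `M`: a left `D`-coaction and a right `E`-coaction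
that commute with each other. -/
structure Bicomodule (K D M E : Type*) [Field K] [AddCommGroup D] [Module K D] [Coalgebra K D]
    [AddCommGroup M] [Module K M] [AddCommGroup E] [Module K E] [Coalgebra K E] where
  left : LeftComodule K D M
  right : RightComodule K M E
  compat : TensorProduct.assoc K D M E ∘ₗ left.coact.rTensor E ∘ₗ right.coact
    = right.coact.lTensor D ∘ₗ left.coact

namespace LeftComodule

variable {K D M N : Type*} [Field K] [AddCommGroup D] [Module K D] [Coalgebra K D]
  [AddCommGroup M] [Module K M] [AddCommGroup N] [Module K N]

/-- The subspace `X` is a subcomodule: the coaction maps `X` into `D ⊗ X`. -/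
def IsSubcomodule (P : LeftComodule K D M) (X : Submodule K M) : Prop :=
  ∀ x ∈ X, P.coact x ∈ LinearMap.range (X.subtype.lTensor D)

/-- Descending chain condition on subcomodules. -/
def IsArtinian (P : LeftComodule K D M) : Prop :=
  WellFoundedLT {X : Submodule K M // P.IsSubcomodule X}

/-- `f` is a morphism of left `D`-comodules. -/
def IsHom (P : LeftComodule K D M) (Q : LeftComodule K D N) (f : M →ₗ[K] N) : Prop :=
  Q.coact ∘ₗ f = f.lTensor D ∘ₗ P.coact

/-- `D` as a left comodule over itself. -/
def regular (K D : Type*) [Field K] [AddCommGroup D] [Module K D] [Coalgebra K D] :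
    LeftComodule K D D where
  coact := Coalgebra.comul
  coassoc := Coalgebra.coassoc
  counit_coact := Coalgebra.rTensor_counit_comp_comul

/-- The direct sum of `n` copies of a left comodule. -/
def power (P : LeftComodule K D M) (n : ℕ) : LeftComodule K D (Fin n → M) where
  coact := ∑ i, (LinearMap.single K (fun _ : Fin n => M) i).lTensor D ∘ₗ P.coact ∘ₗ LinearMap.proj i
  coassoc := by
    refine LinearMap.pi_ext' fun j => LinearMap.ext fun m => ?_
    have h := congrArg (((LinearMap.single K (fun _ : Fin n => M) j).lTensor D).lTensor D)
      (LinearMap.congr_fun P.coassoc m)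
    have key : (∑ i, (LinearMap.single K (fun _ : Fin n => M) i).lTensor D ∘ₗ P.coact ∘ₗ
        LinearMap.proj i) ∘ₗ LinearMap.single K (fun _ : Fin n => M) j
        = (LinearMap.single K (fun _ : Fin n => M) j).lTensor D ∘ₗ P.coact := by
      ext x
      simp only [LinearMap.comp_apply, LinearMap.sum_apply, LinearMap.proj_apply]
      rw [Finset.sum_eq_single j] <;> simp +contextual [Pi.single_eq_of_ne]
    have key' := LinearMap.congr_fun key m
    simp only [LinearMap.comp_apply] at key' h ⊢
    rw [key', ← LinearMap.comp_apply (LinearMap.lTensor D (Finset.sum _ _)),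
      ← LinearMap.lTensor_comp, key, LinearMap.lTensor_comp, LinearMap.comp_apply, ← h]
    generalize P.coact m = t
    induction t with
    | zero => simp
    | add x y hx hy => simp only [map_add, hx, hy]
    | tmul d x =>
      simp only [LinearMap.lTensor_tmul, LinearMap.rTensor_tmul]
      generalize Coalgebra.comul (R := K) d = u
      induction u with
      | zero => simp
      | add x y hx hy => simp only [map_add, TensorProduct.add_tmul, hx, hy]
      | tmul a b => simp
  counit_coact := by
    refine LinearMap.pi_ext' fun j => LinearMap.ext fun m => ?_
    have h := congrArg ((LinearMap.single K (fun _ : Fin n => M) j).lTensor K)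
      (LinearMap.congr_fun P.counit_coact m)
    simp only [LinearMap.comp_apply, LinearMap.sum_apply, LinearMap.proj_apply] at h ⊢
    rw [Finset.sum_eq_single j (by simp +contextual [Pi.single_eq_of_ne]) (by simp)]
    simp only [LinearMap.single_apply, Pi.single_eq_same]
    rw [← LinearMap.comp_apply, LinearMap.rTensor_comp_lTensor, ← LinearMap.lTensor_comp_rTensor,
      LinearMap.comp_apply, h]
    simp

/-- The comodule embeds in `Dⁿ` for some positive integer `n`. -/
def IsFinitelyCogenerated (P : LeftComodule K D M) : Prop :=
  ∃ n : ℕ, 0 < n ∧ ∃ f : M →ₗ[K] (Fin n → D),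
    P.IsHom ((regular K D).power n) f ∧ Function.Injective f

/-- A left `D`-comodule as a `D`-`K`-bicomodule, with the right `K`-coaction `m ↦ m ⊗ 1` that every
vector space has. -/
def toBicomodule (P : LeftComodule K D M) : Bicomodule K D M K where
  left := P
  right :=
    { coact := (TensorProduct.mk K M K).flip 1
      coassoc := by
        ext m; simp
      counit_coact := by
        ext m; simp }
  compat := by
    ext m
    simp only [LinearMap.comp_apply, LinearEquiv.coe_coe, LinearMap.flip_apply,
      TensorProduct.mk_apply, LinearMap.rTensor_tmul]
    generalize P.coact m = t
    induction t with
    | zero => simp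
    | add x y hx hy => simp only [map_add, TensorProduct.add_tmul, hx, hy]
    | tmul a b => simp

end LeftComodule

namespace RightComodule

variable {K E M N : Type*} [Field K] [AddCommGroup E] [Module K E] [Coalgebra K E]
  [AddCommGroup M] [Module K M] [AddCommGroup N] [Module K N]

/-- The subspace `X` is a subcomodule: the coaction maps `X` into `X ⊗ E`. -/
def IsSubcomodule (P : RightComodule K M E) (X : Submodule K M) : Prop :=
  ∀ x ∈ X, P.coact x ∈ LinearMap.range (X.subtype.rTensor E)

/-- Descending chain condition on subcomodules. -/
def IsArtinian (P : RightComodule K M E) : Prop :=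
  WellFoundedLT {X : Submodule K M // P.IsSubcomodule X}

/-- `f` is a morphism of right `E`-comodules. -/
def IsHom (P : RightComodule K M E) (Q : RightComodule K N E) (f : M →ₗ[K] N) : Prop :=
  Q.coact ∘ₗ f = f.rTensor E ∘ₗ P.coact

/-- `E` as a right comodule over itself. -/
def regular (K E : Type*) [Field K] [AddCommGroup E] [Module K E] [Coalgebra K E] :
    RightComodule K E E where
  coact := Coalgebra.comul
  coassoc := Coalgebra.coassoc
  counit_coact := Coalgebra.lTensor_counit_comp_comul

/-- The direct sum of `n` copies of a right comodule. -/
def power (P : RightComodule K M E) (n : ℕ) : RightComodule K (Fin n → M) E where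
  coact := ∑ i, (LinearMap.single K (fun _ : Fin n => M) i).rTensor E ∘ₗ P.coact ∘ₗ LinearMap.proj i
  coassoc := by
    refine LinearMap.pi_ext' fun j => LinearMap.ext fun m => ?_
    have h := congrArg ((LinearMap.single K (fun _ : Fin n => M) j).rTensor (E ⊗[K] E))
      (LinearMap.congr_fun P.coassoc m)
    have key : (∑ i, (LinearMap.single K (fun _ : Fin n => M) i).rTensor E ∘ₗ P.coact ∘ₗ
        LinearMap.proj i) ∘ₗ LinearMap.single K (fun _ : Fin n => M) j
        = (LinearMap.single K (fun _ : Fin n => M) j).rTensor E ∘ₗ P.coact := by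
      ext x
      simp only [LinearMap.comp_apply, LinearMap.sum_apply, LinearMap.proj_apply]
      rw [Finset.sum_eq_single j] <;> simp +contextual [Pi.single_eq_of_ne]
    have key' := LinearMap.congr_fun key m
    simp only [LinearMap.comp_apply] at key' h ⊢
    rw [key', ← LinearMap.comp_apply (LinearMap.rTensor E (Finset.sum _ _)),
      ← LinearMap.rTensor_comp, key, LinearMap.rTensor_comp, LinearMap.comp_apply,
      ← LinearMap.comp_apply (LinearMap.lTensor _ _), LinearMap.lTensor_comp_rTensor,
      ← LinearMap.rTensor_comp_lTensor, LinearMap.comp_apply, ← h]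
    generalize LinearMap.rTensor E P.coact (P.coact m) = t
    induction t with
    | zero => simp
    | add x y hx hy => simp only [map_add, hx, hy]
    | tmul u e =>
      induction u with
      | zero => simp
      | add x y hx hy => simp only [map_add, TensorProduct.add_tmul, hx, hy]
      | tmul a b => simp
  counit_coact := by
    refine LinearMap.pi_ext' fun j => LinearMap.ext fun m => ?_
    have h := congrArg ((LinearMap.single K (fun _ : Fin n => M) j).rTensor K)
      (LinearMap.congr_fun P.counit_coact m)
    simp only [LinearMap.comp_apply, LinearMap.sum_apply, LinearMap.proj_apply] at h ⊢
    rw [Finset.sum_eq_single j (by simp +contextual [Pi.single_eq_of_ne]) (by simp)]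
    simp only [LinearMap.single_apply, Pi.single_eq_same]
    rw [← LinearMap.comp_apply, LinearMap.lTensor_comp_rTensor, ← LinearMap.rTensor_comp_lTensor,
      LinearMap.comp_apply, h]
    simp

/-- The comodule embeds in `Eⁿ` for some positive integer `n`. -/
def IsFinitelyCogenerated (P : RightComodule K M E) : Prop :=
  ∃ n : ℕ, 0 < n ∧ ∃ f : M →ₗ[K] (Fin n → E),
    P.IsHom ((regular K E).power n) f ∧ Function.Injective f

end RightComodule

/-- A coalgebra is left Artinian if it is Artinian as a left comodule over itself. -/
def IsLeftArtinianCoalgebra (K C : Type*) [Field K] [AddCommGroup C] [Module K C]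
    [Coalgebra K C] : Prop :=
  (LeftComodule.regular K C).IsArtinian

/-- A coalgebra is right Artinian if it is Artinian as a right comodule over itself. -/
def IsRightArtinianCoalgebra (K C : Type*) [Field K] [AddCommGroup C] [Module K C]
    [Coalgebra K C] : Prop :=
  (RightComodule.regular K C).IsArtinian

/-- The underlying space `D ⊕ M ⊕ E` of the upper triangular comatrix coalgebra `(D M; 0 E)`
of a `D`-`E`-bicomodule `M`. -/
def TriangularComatrix {K D M E : Type*} [Field K] [AddCommGroup D] [Module K D] [Coalgebra K D]
    [AddCommGroup M] [Module K M] [AddCommGroup E] [Module K E] [Coalgebra K E]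
    (_B : Bicomodule K D M E) : Type _ :=
  D × M × E

namespace TriangularComatrix

variable {K D M E : Type*} [Field K] [AddCommGroup D] [Module K D] [Coalgebra K D]
  [AddCommGroup M] [Module K M] [AddCommGroup E] [Module K E] [Coalgebra K E]
  (B : Bicomodule K D M E)

instance : AddCommGroup (TriangularComatrix B) := inferInstanceAs (AddCommGroup (D × M × E))

instance : Module K (TriangularComatrix B) := inferInstanceAs (Module K (D × M × E))

/-- The inclusion `d ↦ (d 0; 0 0)`. -/
def inD : D →ₗ[K] TriangularComatrix B := LinearMap.inl K D (M × E)

/-- The inclusion `m ↦ (0 m; 0 0)`. -/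
def inM : M →ₗ[K] TriangularComatrix B := LinearMap.inr K D (M × E) ∘ₗ LinearMap.inl K M E

/-- The inclusion `e ↦ (0 0; 0 e)`. -/
def inE : E →ₗ[K] TriangularComatrix B := LinearMap.inr K D (M × E) ∘ₗ LinearMap.inr K M E

/-- The linear map on `(D M; 0 E)` with the given restrictions to `D`, `M` and `E`. -/
def desc {V : Type*} [AddCommGroup V] [Module K V] (f : D →ₗ[K] V) (g : M →ₗ[K] V)
    (h : E →ₗ[K] V) : TriangularComatrix B →ₗ[K] V :=
  LinearMap.coprod f (LinearMap.coprod g h)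

section

variable {V : Type*} [AddCommGroup V] [Module K V] (f : D →ₗ[K] V) (g : M →ₗ[K] V) (h : E →ₗ[K] V)

theorem desc_inD : desc B f g h ∘ₗ inD B = f := by
  ext x; change f x + (g 0 + h 0) = f x; simp

theorem desc_inM : desc B f g h ∘ₗ inM B = g := by
  ext x; change f 0 + (g x + h 0) = g x; simp

theorem desc_inE : desc B f g h ∘ₗ inE B = h := by
  ext x; change f 0 + (g 0 + h x) = h x; simp

theorem hom_ext {p q : TriangularComatrix B →ₗ[K] V} (h₁ : p ∘ₗ inD B = q ∘ₗ inD B)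
    (h₂ : p ∘ₗ inM B = q ∘ₗ inM B) (h₃ : p ∘ₗ inE B = q ∘ₗ inE B) : p = q :=
  LinearMap.prod_ext h₁ (LinearMap.prod_ext h₂ h₃)

end

/-- `Δ d = d₁ ⊗ d₂`, `Δ m = m₍₋₁₎ ⊗ m₍₀₎ + m₍₀₎ ⊗ m₍₁₎`, `Δ e = e₁ ⊗ e₂`;
`ε (d m; 0 e) = ε d + ε e`. -/
noncomputable instance : CoalgebraStruct K (TriangularComatrix B) where
  comul := desc B
    (TensorProduct.map (inD B) (inD B) ∘ₗ Coalgebra.comul)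
    (TensorProduct.map (inD B) (inM B) ∘ₗ B.left.coact
      + TensorProduct.map (inM B) (inE B) ∘ₗ B.right.coact)
    (TensorProduct.map (inE B) (inE B) ∘ₗ Coalgebra.comul)
  counit := desc B Coalgebra.counit 0 Coalgebra.counit

theorem comul_inD (d : D) : Coalgebra.comul (R := K) (inD B d)
    = TensorProduct.map (inD B) (inD B) (Coalgebra.comul d) :=
  LinearMap.congr_fun (desc_inD B _ _ _) d

theorem comul_inM (m : M) : Coalgebra.comul (R := K) (inM B m)
    = TensorProduct.map (inD B) (inM B) (B.left.coact m)
      + TensorProduct.map (inM B) (inE B) (B.right.coact m) :=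
  LinearMap.congr_fun (desc_inM B _ _ _) m

theorem comul_inE (e : E) : Coalgebra.comul (R := K) (inE B e)
    = TensorProduct.map (inE B) (inE B) (Coalgebra.comul e) :=
  LinearMap.congr_fun (desc_inE B _ _ _) e

theorem counit_inD (d : D) : Coalgebra.counit (R := K) (inD B d) = Coalgebra.counit (R := K) d :=
  LinearMap.congr_fun (desc_inD B _ _ _) d

theorem counit_inM (m : M) : Coalgebra.counit (R := K) (inM B m) = 0 :=
  LinearMap.congr_fun (desc_inM B _ _ _) m

theorem counit_inE (e : E) : Coalgebra.counit (R := K) (inE B e) = Coalgebra.counit (R := K) e :=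
  LinearMap.congr_fun (desc_inE B _ _ _) e

theorem comul_comp_inD : Coalgebra.comul ∘ₗ inD B
    = TensorProduct.map (inD B) (inD B) ∘ₗ Coalgebra.comul := desc_inD B _ _ _

theorem comul_comp_inM : Coalgebra.comul ∘ₗ inM B
    = TensorProduct.map (inD B) (inM B) ∘ₗ B.left.coact
      + TensorProduct.map (inM B) (inE B) ∘ₗ B.right.coact := desc_inM B _ _ _

theorem comul_comp_inE : Coalgebra.comul ∘ₗ inE B
    = TensorProduct.map (inE B) (inE B) ∘ₗ Coalgebra.comul := desc_inE B _ _ _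

theorem counit_comp_inD : Coalgebra.counit ∘ₗ inD B = Coalgebra.counit (R := K) :=
  desc_inD B _ _ _

theorem counit_comp_inM : Coalgebra.counit ∘ₗ inM B = (0 : M →ₗ[K] K) := desc_inM B _ _ _

theorem counit_comp_inE : Coalgebra.counit ∘ₗ inE B = Coalgebra.counit (R := K) :=
  desc_inE B _ _ _

section

variable {S T U V W X : Type*} [AddCommGroup S] [Module K S] [AddCommGroup T] [Module K T]
  [AddCommGroup U] [Module K U] [AddCommGroup V] [Module K V] [AddCommGroup W] [Module K W]
  [AddCommGroup X] [Module K X]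

theorem assoc_map_aux (f : S →ₗ[K] V) (g : T →ₗ[K] V) (h : U →ₗ[K] V) (p : W →ₗ[K] S ⊗[K] T)
    (t : W ⊗[K] U) :
    TensorProduct.assoc K V V V (TensorProduct.map (TensorProduct.map f g ∘ₗ p) h t)
      = TensorProduct.map f (TensorProduct.map g h)
          (TensorProduct.assoc K S T U (p.rTensor U t)) := by
  induction t with
  | zero => simp
  | add x y hx hy => simp only [map_add, hx, hy]
  | tmul w u =>
    simp only [TensorProduct.map_tmul, LinearMap.comp_apply, LinearMap.rTensor_tmul]
    generalize p w = r
    induction r with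
    | zero => simp
    | add x y hx hy => simp only [map_add, TensorProduct.add_tmul, hx, hy]
    | tmul a b => simp

theorem map_comp_aux (f : S →ₗ[K] V) (g : T →ₗ[K] V) (h : U →ₗ[K] V) (p : W →ₗ[K] T ⊗[K] U)
    (t : S ⊗[K] W) :
    TensorProduct.map f (TensorProduct.map g h ∘ₗ p) t
      = TensorProduct.map f (TensorProduct.map g h) (p.lTensor S t) := by
  rw [← LinearMap.comp_apply (TensorProduct.map f _), LinearMap.map_comp_lTensor]

theorem map_counit_left_aux (p : W →ₗ[K] K) (g : T →ₗ[K] V) (t : W ⊗[K] T) :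
    TensorProduct.map p g t = g.lTensor K (p.rTensor T t) := by
  rw [← LinearMap.comp_apply, LinearMap.lTensor_comp_rTensor]

theorem map_counit_right_aux (p : W →ₗ[K] K) (g : T →ₗ[K] V) (t : T ⊗[K] W) :
    TensorProduct.map g p t = g.rTensor K (p.lTensor T t) := by
  rw [← LinearMap.comp_apply, LinearMap.rTensor_comp_lTensor]

end

noncomputable instance : Coalgebra K (TriangularComatrix B) where
  coassoc := by
    apply hom_ext B <;> ext x <;> simp only [LinearMap.comp_apply, LinearEquiv.coe_coe]
    · rw [comul_inD, LinearMap.rTensor_map, LinearMap.lTensor_map, comul_comp_inD, assoc_map_aux,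
        map_comp_aux, Coalgebra.coassoc_apply]
    · have h₁ := LinearMap.congr_fun B.left.coassoc x
      have h₂ := LinearMap.congr_fun B.right.coassoc x
      have h₃ := LinearMap.congr_fun B.compat x
      simp only [LinearMap.comp_apply, LinearEquiv.coe_coe] at h₁ h₂ h₃
      rw [comul_inM]
      simp only [map_add, LinearMap.rTensor_map, LinearMap.lTensor_map]
      rw [comul_comp_inD, comul_comp_inM, comul_comp_inE, TensorProduct.map_add_left,
        TensorProduct.map_add_right]
      simp only [LinearMap.add_apply, map_add, assoc_map_aux, map_comp_aux, h₁, h₂, h₃]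
      abel
    · rw [comul_inE, LinearMap.rTensor_map, LinearMap.lTensor_map, comul_comp_inE, assoc_map_aux,
        map_comp_aux, Coalgebra.coassoc_apply]
  rTensor_counit_comp_comul := by
    apply hom_ext B <;> ext x <;> simp only [LinearMap.comp_apply]
    · rw [comul_inD, LinearMap.rTensor_map, counit_comp_inD, map_counit_left_aux]
      simp
    · have h := LinearMap.congr_fun B.left.counit_coact x
      simp only [LinearMap.comp_apply] at h
      rw [comul_inM, map_add, LinearMap.rTensor_map, LinearMap.rTensor_map, counit_comp_inD,
        counit_comp_inM, map_counit_left_aux, h]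
      simp
    · rw [comul_inE, LinearMap.rTensor_map, counit_comp_inE, map_counit_left_aux]
      simp
  lTensor_counit_comp_comul := by
    apply hom_ext B <;> ext x <;> simp only [LinearMap.comp_apply]
    · rw [comul_inD, LinearMap.lTensor_map, counit_comp_inD, map_counit_right_aux]
      simp
    · have h := LinearMap.congr_fun B.right.counit_coact x
      simp only [LinearMap.comp_apply] at h
      rw [comul_inM, map_add, LinearMap.lTensor_map, LinearMap.lTensor_map, counit_comp_inE,
        counit_comp_inM, map_counit_right_aux, map_counit_right_aux, h]
      simp
    · rw [comul_inE, LinearMap.lTensor_map, counit_comp_inE, map_counit_right_aux]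
      simp

end TriangularComatrix

/-- The underlying space of the divided power coalgebra, with basis `c₀, c₁, c₂, …`. -/
def DividedPowerCoalgebra (K : Type*) [Field K] : Type _ := ℕ →₀ K

namespace DividedPowerCoalgebra

variable (K : Type*) [Field K]

noncomputable instance : AddCommGroup (DividedPowerCoalgebra K) :=
  inferInstanceAs (AddCommGroup (ℕ →₀ K))

noncomputable instance : Module K (DividedPowerCoalgebra K) := inferInstanceAs (Module K (ℕ →₀ K))

/-- The basis `c₀, c₁, c₂, …`. -/
noncomputable def basis : Module.Basis ℕ K (DividedPowerCoalgebra K) :=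
  Module.Basis.ofRepr (LinearEquiv.refl K (ℕ →₀ K))

/-- `Δ cₙ = ∑_{i + j = n} cᵢ ⊗ cⱼ`; `ε c₀ = 1` and `ε cₙ = 0` for `n > 0`. -/
noncomputable instance : CoalgebraStruct K (DividedPowerCoalgebra K) where
  comul := (basis K).constr K
    (fun n => ∑ p ∈ Finset.HasAntidiagonal.antidiagonal n, basis K p.1 ⊗ₜ[K] basis K p.2)
  counit := (basis K).constr K (fun n => if n = 0 then (1 : K) else 0)

theorem comul_basis (n : ℕ) : Coalgebra.comul (R := K) (basis K n)
    = ∑ p ∈ Finset.HasAntidiagonal.antidiagonal n, basis K p.1 ⊗ₜ[K] basis K p.2 :=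
  (basis K).constr_basis K _ n

theorem counit_basis (n : ℕ) : Coalgebra.counit (R := K) (basis K n) = if n = 0 then (1 : K) else 0 :=
  (basis K).constr_basis K _ n

noncomputable instance : Coalgebra K (DividedPowerCoalgebra K) where
  coassoc := by
    refine (basis K).ext fun n => ?_
    simp only [LinearMap.comp_apply, LinearEquiv.coe_coe, comul_basis, map_sum,
      LinearMap.rTensor_tmul, LinearMap.lTensor_tmul, TensorProduct.sum_tmul,
      TensorProduct.tmul_sum, TensorProduct.assoc_tmul]
    rw [Finset.sum_sigma', Finset.sum_sigma']
    refine Finset.sum_nbij' (fun p => ⟨(p.2.1, p.2.2 + p.1.2), (p.2.2, p.1.2)⟩)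
      (fun p => ⟨(p.1.1 + p.2.1, p.2.2), (p.1.1, p.2.1)⟩) ?_ ?_ ?_ ?_ ?_
    · rintro ⟨⟨a, b⟩, c, d⟩ h
      simp only [Finset.mem_sigma, Finset.HasAntidiagonal.mem_antidiagonal] at h ⊢
      obtain ⟨h₁, h₂⟩ := h
      exact ⟨by omega, trivial⟩
    · rintro ⟨⟨a, b⟩, c, d⟩ h
      simp only [Finset.mem_sigma, Finset.HasAntidiagonal.mem_antidiagonal] at h ⊢
      obtain ⟨h₁, h₂⟩ := h
      exact ⟨by omega, trivial⟩
    · rintro ⟨⟨a, b⟩, c, d⟩ h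
      simp only [Finset.mem_sigma, Finset.HasAntidiagonal.mem_antidiagonal] at h
      obtain ⟨_, rfl⟩ := h
      rfl
    · rintro ⟨⟨a, b⟩, c, d⟩ h
      simp only [Finset.mem_sigma, Finset.HasAntidiagonal.mem_antidiagonal] at h
      obtain ⟨_, rfl⟩ := h
      rfl
    · rintro ⟨⟨a, b⟩, c, d⟩ h
      rfl
  rTensor_counit_comp_comul := by
    refine (basis K).ext fun n => ?_
    simp only [LinearMap.comp_apply, comul_basis, map_sum, LinearMap.rTensor_tmul, counit_basis,
      TensorProduct.mk_apply]
    rw [Finset.sum_eq_single (0, n)]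
    · simp
    · rintro ⟨a, b⟩ h hne
      have : a ≠ 0 := by
        rintro rfl
        simp_all
      simp [this]
    · simp
  lTensor_counit_comp_comul := by
    refine (basis K).ext fun n => ?_
    simp only [LinearMap.comp_apply, comul_basis, map_sum, LinearMap.lTensor_tmul, counit_basis,
      LinearMap.flip_apply, TensorProduct.mk_apply]
    rw [Finset.sum_eq_single (n, 0)]
    · simp
    · rintro ⟨a, b⟩ h hne
      have : b ≠ 0 := by
        rintro rfl
        simp_all
      simp [this]
    · simp

end DividedPowerCoalgebra

/-! A functional on a coalgebra acts on any comodule by being applied to the coalgebra leg of the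
coaction, and the subcomodules are exactly the subspaces stable under all these operators
(`isSubcomodule_iff`). The chain condition thus becomes the Artinian property of a module. The free
algebra on the dual space serves as the ring: its submodules are the same invariant subspaces as for
the convolution algebra, and no relations need checking.

Let `C` be the triangular coalgebra. As a left comodule it contains `E`, with quotient `D ⊕ M`, and
the dual of `C` acts on these pieces through restriction to `E` or to `D`. Restriction of
functionals is surjective, so `C` is left Artinian iff `E`, `D` and the left comodule `M` are. On
the right, `D` is the subcomodule and `M ⊕ E` the quotient.

It remains to compare Artinian with finitely cogenerated. A subcomodule of a finite power of an
Artinian coalgebra is Artinian. Conversely, the coefficient maps from a comodule to its coalgebra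
separate points, because the counit recovers the functional defining each of them (`counit_coeff`);
in an Artinian comodule finitely many already separate points and give the embedding.

For `(D D; 0 K)` the right condition forces `D` to be finite dimensional. In the divided power
coalgebra the coordinate functionals act as downward shifts, so every proper subcomodule is finite
dimensional. -/

theorem wellFoundedLT_subtype_congr {α : Type*} [Preorder α] {p q : α → Prop}
    (h : ∀ x, p x ↔ q x) : WellFoundedLT {x // p x} ↔ WellFoundedLT {x // q x} := by
  obtain rfl : p = q := funext fun x => propext (h x)
  rfl

/-! ### Families of operators as modules over a free algebra -/

/-- The space `M` with a family `ρ` of operators, as a module over the free algebra on the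
index set of the family. -/
def OperatorModule {K M I : Type*} [Field K] [AddCommGroup M] [Module K M]
    (_ρ : I → Module.End K M) : Type _ := M

namespace OperatorModule

variable {K M N I J : Type*} [Field K] [AddCommGroup M] [Module K M] [AddCommGroup N] [Module K N]

instance (ρ : I → Module.End K M) : AddCommGroup (OperatorModule ρ) :=
  inferInstanceAs (AddCommGroup M)

noncomputable instance (ρ : I → Module.End K M) : Module (FreeAlgebra K I) (OperatorModule ρ) :=
  Module.compHom M (FreeAlgebra.lift K ρ).toRingHom

/-- The tautological identification of `M` with the operator module. -/
def of (ρ : I → Module.End K M) : M ≃+ OperatorModule ρ := AddEquiv.refl M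

theorem smul_of (ρ : I → Module.End K M) (a : FreeAlgebra K I) (m : M) :
    a • of ρ m = of ρ (FreeAlgebra.lift K ρ a m) := rfl

theorem ι_smul_of (ρ : I → Module.End K M) (i : I) (m : M) :
    FreeAlgebra.ι K i • of ρ m = of ρ (ρ i m) := by
  rw [smul_of, FreeAlgebra.lift_ι_apply]

theorem algebraMap_smul_of (ρ : I → Module.End K M) (c : K) (m : M) :
    algebraMap K (FreeAlgebra K I) c • of ρ m = of ρ (c • m) := by
  rw [smul_of, AlgHom.commutes, Module.algebraMap_end_apply]

theorem lift_mem {ρ : I → Module.End K M} {X : Submodule K M} (h : ∀ i, ∀ x ∈ X, ρ i x ∈ X)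
    (a : FreeAlgebra K I) : ∀ x ∈ X, FreeAlgebra.lift K ρ a x ∈ X := by
  induction a with
  | grade0 c => intro x hx; simpa using X.smul_mem c hx
  | grade1 i => intro x hx; simpa using h i x hx
  | mul a b ha hb => intro x hx; simpa using ha _ (hb x hx)
  | add a b ha hb => intro x hx; simpa using X.add_mem (ha x hx) (hb x hx)

/-- Submodules of the operator module are the subspaces invariant under all operators. -/
def submoduleEquiv (ρ : I → Module.End K M) :
    Submodule (FreeAlgebra K I) (OperatorModule ρ) ≃o
      {X : Submodule K M // ∀ i, ∀ x ∈ X, ρ i x ∈ X} where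
  toFun Y := ⟨{ carrier := {x | of ρ x ∈ Y}
                add_mem' := fun ha hb => Y.add_mem ha hb
                zero_mem' := Y.zero_mem
                -- The free algebra contains `K`, so its submodules are automatically `K`-subspaces.
                smul_mem' := fun c x hx => by
                  have := Y.smul_mem (algebraMap K _ c) (show of ρ x ∈ Y from hx)
                  rwa [algebraMap_smul_of] at this },
    fun i x hx => by
      have := Y.smul_mem (FreeAlgebra.ι K i) (show of ρ x ∈ Y from hx)
      rwa [ι_smul_of] at this⟩
  invFun X := { carrier := {x | (of ρ).symm x ∈ X.1}
                add_mem' := fun ha hb => X.1.add_mem ha hb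
                zero_mem' := X.1.zero_mem
                smul_mem' := fun a x hx => lift_mem X.2 a _ hx }
  left_inv _ := rfl
  right_inv _ := rfl
  map_rel_iff' := Iff.rfl

theorem isArtinian_iff (ρ : I → Module.End K M) :
    IsArtinian (FreeAlgebra K I) (OperatorModule ρ) ↔
      WellFoundedLT {X : Submodule K M // ∀ i, ∀ x ∈ X, ρ i x ∈ X} :=
  ⟨fun _ => (submoduleEquiv ρ).symm.strictMono.wellFoundedLT,
    fun _ => (submoduleEquiv ρ).strictMono.wellFoundedLT⟩

/-- Reindexing the operators along a surjection does not change the invariant subspaces. -/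
theorem isArtinian_comp_iff (ρ : I → Module.End K M) {u : J → I} (hu : Function.Surjective u) :
    IsArtinian (FreeAlgebra K J) (OperatorModule (ρ ∘ u)) ↔
      IsArtinian (FreeAlgebra K I) (OperatorModule ρ) := by
  rw [isArtinian_iff, isArtinian_iff]
  exact wellFoundedLT_subtype_congr fun X => (hu.forall (p := fun i => ∀ x ∈ X, ρ i x ∈ X)).symm

theorem lift_apply_comm {ρ : I → Module.End K M} {σ : I → Module.End K N} {f : M →ₗ[K] N}
    (h : ∀ i m, f (ρ i m) = σ i (f m)) (a : FreeAlgebra K I) :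
    ∀ m, f (FreeAlgebra.lift K ρ a m) = FreeAlgebra.lift K σ a (f m) := by
  induction a with
  | grade0 c => simp
  | grade1 i => simpa using h i
  | mul a b ha hb => simp [ha, hb]
  | add a b ha hb => simp [ha, hb]

/-- A linear map commuting with the operators, as a map of operator modules. -/
def map {ρ : I → Module.End K M} {σ : I → Module.End K N} (f : M →ₗ[K] N)
    (h : ∀ i m, f (ρ i m) = σ i (f m)) :
    OperatorModule ρ →ₗ[FreeAlgebra K I] OperatorModule σ where
  toFun := f
  map_add' := f.map_add
  map_smul' a m := lift_apply_comm h a m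

/-- Artinian operator modules when the middle space is built from a sub and two quotients. -/
theorem isArtinian_iff_of_exact {P Q : Type*} [AddCommGroup P] [Module K P] [AddCommGroup Q]
    [Module K Q] {ρ : I → Module.End K M} {σ : I → Module.End K N} {τ : I → Module.End K P}
    {υ : I → Module.End K Q} (f : N →ₗ[K] M) (g : M →ₗ[K] P) (h : M →ₗ[K] Q)
    (hf : ∀ i m, f (σ i m) = ρ i (f m)) (hg : ∀ i m, g (ρ i m) = τ i (g m))
    (hh : ∀ i m, h (ρ i m) = υ i (h m)) (inj : Function.Injective f)
    (surjg : Function.Surjective g) (surjh : Function.Surjective h)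
    (exact : ∀ m, g m = 0 → h m = 0 → ∃ n, f n = m) (hgf : ∀ n, g (f n) = 0)
    (hhf : ∀ n, h (f n) = 0) :
    IsArtinian (FreeAlgebra K I) (OperatorModule ρ) ↔
      IsArtinian (FreeAlgebra K I) (OperatorModule σ) ∧
        IsArtinian (FreeAlgebra K I) (OperatorModule τ) ∧
        IsArtinian (FreeAlgebra K I) (OperatorModule υ) := by
  constructor
  · intro _
    exact ⟨isArtinian_of_injective (map f hf) inj, isArtinian_of_surjective _ (map g hg) surjg,
      isArtinian_of_surjective _ (map h hh) surjh⟩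
  · rintro ⟨_, _, _⟩
    -- Only the kernel of the pair `(g, h)` matters here; joint surjectivity onto `P × Q` is not
    -- needed.
    refine isArtinian_of_range_eq_ker (map f hf) ((map g hg).prod (map h hh)) ?_
    ext m
    rw [LinearMap.mem_ker]
    constructor
    · rintro ⟨n, rfl⟩
      exact Prod.ext (hgf n) (hhf n)
    · intro hm
      exact exact m (congrArg Prod.fst hm) (congrArg Prod.snd hm)

end OperatorModule

/-- In an Artinian module, a separating family of linear maps has a finite separating subfamily. -/
theorem IsArtinian.exists_finset_separating {R M N J : Type*} [Ring R] [AddCommGroup M] [Module R M]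
    [AddCommGroup N] [Module R N] [IsArtinian R M] (g : J → M →ₗ[R] N)
    (h : ∀ m, (∀ j, g j m = 0) → m = 0) :
    ∃ s : Finset J, ∀ m, (∀ j ∈ s, g j m = 0) → m = 0 := by
  classical
  -- Take a minimal finite intersection of kernels: adjoining one more kernel cannot shrink it, so
  -- it lies in every kernel.
  obtain ⟨_, ⟨s, rfl⟩, hs⟩ := IsArtinian.set_has_minimal
    (Set.range fun s : Finset J => ⨅ j ∈ s, LinearMap.ker (g j)) ⟨_, ∅, rfl⟩
  refine ⟨s, fun m hm => h m fun j => ?_⟩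
  by_contra hj
  refine hs _ ⟨insert j s, rfl⟩ (lt_of_le_of_ne ?_ fun he => hj ?_)
  · exact biInf_mono fun i hi => Finset.mem_insert_of_mem hi
  · have : m ∈ ⨅ j ∈ s, LinearMap.ker (g j) := by simpa using hm
    rw [← show _ = ⨅ j ∈ s, LinearMap.ker (g j) from he] at this
    simp only [Submodule.mem_iInf, LinearMap.mem_ker] at this
    exact this j (Finset.mem_insert_self j s)

namespace OperatorModule

variable {K M N I J : Type*} [Field K] [AddCommGroup M] [Module K M] [AddCommGroup N] [Module K N]
  {ρ : I → Module.End K M} {σ : I → Module.End K N}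

theorem exists_finset_separating (hM : IsArtinian (FreeAlgebra K I) (OperatorModule ρ))
    (g : J → M →ₗ[K] N) (hg : ∀ j i m, g j (ρ i m) = σ i (g j m))
    (h : ∀ m, (∀ j, g j m = 0) → m = 0) :
    ∃ s : Finset J, ∀ m, (∀ j ∈ s, g j m = 0) → m = 0 :=
  IsArtinian.exists_finset_separating (fun j => map (g j) (hg j)) h

/-- A finite separating family is an embedding into a finite power of `N`. -/
theorem isArtinian_of_separating [Finite J]
    (hN : IsArtinian (FreeAlgebra K I) (OperatorModule σ))
    (g : J → M →ₗ[K] N) (hg : ∀ j i m, g j (ρ i m) = σ i (g j m))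
    (h : ∀ m, (∀ j, g j m = 0) → m = 0) :
    IsArtinian (FreeAlgebra K I) (OperatorModule ρ) :=
  isArtinian_of_injective (LinearMap.pi fun j => map (g j) (hg j))
    ((injective_iff_map_eq_zero _).2 fun m hm => h m fun j => congrFun hm j)

end OperatorModule

/-! ### Detecting tensors by slicing with functionals -/

section Slices

variable {K V W : Type*} [Field K] [AddCommGroup V] [Module K V] [AddCommGroup W] [Module K W]

/-- The coordinate functionals of a basis of `V` already read off all coefficients of `t` in `W`. -/
theorem TensorProduct.eq_zero_of_rTensor_dual (t : V ⊗[K] W)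
    (h : ∀ u : Module.Dual K V, TensorProduct.lid K W (u.rTensor W t) = 0) : t = 0 := by
  classical
  let b := Module.Basis.ofVectorSpace K V
  apply (TensorProduct.equivFinsuppOfBasisLeft b).injective
  ext i
  rw [map_zero, Finsupp.zero_apply, ← h (b.coord i)]
  clear h
  induction t with
  | zero => simp
  | add x y hx hy => simp_all
  | tmul v w => simp

/-- By right exactness, `t` comes from `V ⊗ X` iff its image in `V ⊗ (W ⧸ X)` vanishes, and slices
detect this vanishing. -/
theorem TensorProduct.mem_range_lTensor_iff (X : Submodule K W) (t : V ⊗[K] W) :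
    t ∈ LinearMap.range (X.subtype.lTensor V) ↔
      ∀ u : Module.Dual K V, TensorProduct.lid K W (u.rTensor W t) ∈ X := by
  have key (u : Module.Dual K V) : TensorProduct.lid K (W ⧸ X) (u.rTensor _ (X.mkQ.lTensor V t))
      = X.mkQ (TensorProduct.lid K W (u.rTensor W t)) := by
    induction t with
    | zero => simp
    | add x y hx hy => simp_all
    | tmul v w => simp
  have ex := lTensor_exact V (f := X.subtype) (g := X.mkQ) (LinearMap.exact_subtype_mkQ X)
    X.mkQ_surjective
  rw [LinearMap.mem_range, ← Set.mem_range, ← ex t]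
  constructor
  · intro h u
    rw [← Submodule.ker_mkQ X, LinearMap.mem_ker, ← key, h]
    simp
  · intro h
    refine TensorProduct.eq_zero_of_rTensor_dual _ fun u => ?_
    rw [key, ← LinearMap.mem_ker, Submodule.ker_mkQ]
    exact h u

theorem TensorProduct.mem_range_rTensor_iff (X : Submodule K V) (t : V ⊗[K] W) :
    t ∈ LinearMap.range (X.subtype.rTensor W) ↔
      ∀ u : Module.Dual K W, TensorProduct.rid K V (u.lTensor V t) ∈ X := by
  have h₁ : t ∈ LinearMap.range (X.subtype.rTensor W) ↔
      TensorProduct.comm K V W t ∈ LinearMap.range (X.subtype.lTensor W) := by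
    simp only [LinearMap.mem_range]
    constructor
    · rintro ⟨s, rfl⟩
      exact ⟨TensorProduct.comm K _ _ s, by rw [← LinearMap.comm_comp_rTensor_comp_comm_eq]; simp⟩
    · rintro ⟨s, hs⟩
      refine ⟨TensorProduct.comm K _ _ s, (TensorProduct.comm K V W).injective ?_⟩
      rw [← hs, ← LinearMap.comm_comp_rTensor_comp_comm_eq]; simp
  rw [h₁, TensorProduct.mem_range_lTensor_iff]
  refine forall_congr' fun u => ?_
  suffices TensorProduct.lid K V (u.rTensor V (TensorProduct.comm K V W t))
    = TensorProduct.rid K V (u.lTensor V t) by rw [this]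
  clear h₁
  induction t with
  | zero => simp
  | add x y hx hy => simp_all
  | tmul v w => simp

end Slices

/-! ### Left comodules: the dual action and finite cogeneration -/

namespace LeftComodule

variable {K D M N : Type*} [Field K] [AddCommGroup D] [Module K D] [Coalgebra K D]
  [AddCommGroup M] [Module K M] [AddCommGroup N] [Module K N]

/-- The action `m ↦ u(m₍₋₁₎) m₍₀₎` of a functional `u` on `D`. -/
noncomputable def dualAct (P : LeftComodule K D M) (u : Module.Dual K D) : Module.End K M :=
  TensorProduct.lid K M ∘ₗ u.rTensor M ∘ₗ P.coact

theorem dualAct_apply (P : LeftComodule K D M) (u : Module.Dual K D) (m : M) :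
    P.dualAct u m = TensorProduct.lid K M (u.rTensor M (P.coact m)) := rfl

theorem isSubcomodule_iff (P : LeftComodule K D M) (X : Submodule K M) :
    P.IsSubcomodule X ↔ ∀ u, ∀ x ∈ X, P.dualAct u x ∈ X := by
  simp only [IsSubcomodule, TensorProduct.mem_range_lTensor_iff, dualAct_apply]
  exact ⟨fun h u x hx => h x hx u, fun h x hx u => h u x hx⟩

theorem isArtinian_iff (P : LeftComodule K D M) :
    P.IsArtinian ↔
      _root_.IsArtinian (FreeAlgebra K (Module.Dual K D)) (OperatorModule P.dualAct) := by
  rw [OperatorModule.isArtinian_iff, IsArtinian]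
  exact wellFoundedLT_subtype_congr P.isSubcomodule_iff

theorem IsHom.dualAct {P : LeftComodule K D M} {Q : LeftComodule K D N} {f : M →ₗ[K] N}
    (h : P.IsHom Q f) (u : Module.Dual K D) (m : M) : f (P.dualAct u m) = Q.dualAct u (f m) := by
  have := LinearMap.congr_fun h m
  simp only [LinearMap.comp_apply] at this
  rw [dualAct_apply, dualAct_apply, this]
  generalize P.coact m = t
  induction t with
  | zero => simp
  | add x y hx hy => simp_all
  | tmul v w => simp

/-- The comodule map `m ↦ m₍₋₁₎ u(m₍₀₎)` into `D` given by a functional `u` on `M`. -/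
noncomputable def coeff (P : LeftComodule K D M) (u : Module.Dual K M) : M →ₗ[K] D :=
  TensorProduct.rid K D ∘ₗ u.lTensor D ∘ₗ P.coact

/-- Counitality in the form that makes the coefficient maps separate points: if all of them kill
`m`, so does every functional. -/
theorem counit_coeff (P : LeftComodule K D M) (u : Module.Dual K M) (m : M) :
    Coalgebra.counit (R := K) (P.coeff u m) = u m := by
  have h := congrArg (fun t => TensorProduct.lid K K (u.lTensor K t))
    (LinearMap.congr_fun P.counit_coact m)
  simp only [TensorProduct.mk_apply, LinearMap.lTensor_tmul, TensorProduct.lid_tmul, one_smul,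
    LinearMap.comp_apply] at h
  rw [← h, coeff, LinearMap.comp_apply, LinearMap.comp_apply, LinearEquiv.coe_coe]
  clear h
  generalize P.coact m = t
  induction t with
  | zero => simp
  | add x y hx hy => simp_all
  | tmul v w => simp [mul_comm]

/-- This is coassociativity with `u` applied to the leg in `M`. -/
theorem isHom_coeff (P : LeftComodule K D M) (u : Module.Dual K M) :
    P.IsHom (regular K D) (P.coeff u) := by
  refine LinearMap.ext fun m => ?_
  have h := congrArg (fun t => (TensorProduct.rid K D).toLinearMap.lTensor D
    ((u.lTensor D).lTensor D t)) (LinearMap.congr_fun P.coassoc m)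
  simp only [LinearMap.comp_apply, LinearEquiv.coe_coe] at h ⊢
  rw [coeff, LinearMap.lTensor_comp, LinearMap.lTensor_comp]
  simp only [LinearMap.comp_apply, LinearEquiv.coe_coe, regular]
  rw [← h]
  clear h
  generalize P.coact m = t
  induction t with
  | zero => simp
  | add x y hx hy => simp_all
  | tmul v w =>
    simp only [LinearMap.lTensor_tmul, LinearMap.rTensor_tmul, TensorProduct.rid_tmul, map_smul]
    generalize Coalgebra.comul (R := K) v = s
    induction s with
    | zero => simp
    | add x y hx hy => simp_all [TensorProduct.add_tmul]
    | tmul a b => simp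

theorem isHom_power_proj (P : LeftComodule K D M) (n : ℕ) (j : Fin n) :
    (P.power n).IsHom P (LinearMap.proj j) := by
  refine LinearMap.ext fun m => ?_
  simp only [power, LinearMap.comp_apply, LinearMap.sum_apply, map_sum, LinearMap.proj_apply,
    ← LinearMap.lTensor_comp_apply]
  rw [Finset.sum_eq_single j]
  · rw [LinearMap.proj_comp_single_same]; simp
  · intro i _ hi
    rw [LinearMap.proj_comp_single_ne _ _ _ _ hi.symm]; simp
  · simp

theorem IsHom.comp {P : LeftComodule K D M} {Q : LeftComodule K D N} {L : Type*} [AddCommGroup L]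
    [Module K L] {R : LeftComodule K D L} {g : N →ₗ[K] L} {f : M →ₗ[K] N} (hg : Q.IsHom R g)
    (hf : P.IsHom Q f) : P.IsHom R (g ∘ₗ f) := by
  rw [IsHom] at *
  rw [← LinearMap.comp_assoc, hg, LinearMap.comp_assoc, hf, LinearMap.lTensor_comp,
    LinearMap.comp_assoc]

theorem isHom_pi {P : LeftComodule K D M} {Q : LeftComodule K D N} {n : ℕ}
    {f : Fin n → M →ₗ[K] N} (hf : ∀ i, P.IsHom Q (f i)) :
    P.IsHom (Q.power n) (LinearMap.pi f) := by
  have e : LinearMap.pi f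
      = ∑ i, LinearMap.single K (fun _ : Fin n => N) i ∘ₗ f i := by
    ext m j
    simp [LinearMap.sum_apply, Pi.single_apply]
  refine LinearMap.ext fun m => ?_
  have h (i : Fin n) := LinearMap.congr_fun (hf i) m
  simp only [LinearMap.comp_apply] at h
  have e' : (LinearMap.pi f).lTensor D
      = ∑ i, (LinearMap.single K (fun _ : Fin n => N) i ∘ₗ f i).lTensor D := by
    rw [e]
    exact map_sum (LinearMap.lTensorHom D) _ _
  simp only [e', power, LinearMap.sum_apply, LinearMap.comp_apply, LinearMap.proj_apply,
    LinearMap.pi_apply, h, LinearMap.lTensor_comp]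

/-- The chain condition on `M` alone cuts the separating family of coefficient maps down to a finite
one; `D` need not be Artinian. -/
theorem IsArtinian.isFinitelyCogenerated {P : LeftComodule K D M} (h : P.IsArtinian) :
    P.IsFinitelyCogenerated := by
  classical
  rw [isArtinian_iff] at h
  obtain ⟨s, hs⟩ := OperatorModule.exists_finset_separating h P.coeff
    (fun u => (P.isHom_coeff u).dualAct) fun m hm => by
      refine (Module.forall_dual_apply_eq_zero_iff K (V := M) m).1 fun u => ?_
      rw [← P.counit_coeff u, hm, map_zero]
  -- `s` may be empty when `M = 0`; adjoining the zero functional makes the number of copies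
  -- positive.
  let e := (insert 0 s).equivFin
  refine ⟨(insert 0 s).card, by simp, LinearMap.pi fun i => P.coeff (e.symm i),
    isHom_pi fun i => P.isHom_coeff _, (injective_iff_map_eq_zero _).2 fun m hm => ?_⟩
  refine hs m fun u hu => ?_
  have := congrFun hm (e ⟨u, Finset.mem_insert_of_mem hu⟩)
  rw [LinearMap.pi_apply, e.symm_apply_apply] at this
  exact this

theorem IsFinitelyCogenerated.isArtinian {P : LeftComodule K D M} (h : P.IsFinitelyCogenerated)
    (hD : IsLeftArtinianCoalgebra K D) : P.IsArtinian := by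
  obtain ⟨n, -, f, hf, inj⟩ := h
  rw [IsLeftArtinianCoalgebra, isArtinian_iff] at hD
  rw [isArtinian_iff]
  exact OperatorModule.isArtinian_of_separating hD _
    (fun i => ((isHom_power_proj _ n i).comp hf).dualAct)
    fun m hm => inj ((funext hm).trans (map_zero f).symm)

theorem isArtinian_of_finiteDimensional (P : LeftComodule K D M) [FiniteDimensional K M] :
    P.IsArtinian :=
  (Subtype.strictMono_coe _).wellFoundedLT

end LeftComodule

/-! ### Right comodules: the mirror statements -/

namespace RightComodule

variable {K E M N : Type*} [Field K] [AddCommGroup E] [Module K E] [Coalgebra K E]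
  [AddCommGroup M] [Module K M] [AddCommGroup N] [Module K N]

/-- The action `m ↦ m₍₀₎ u(m₍₁₎)` of a functional `u` on `E`. -/
noncomputable def dualAct (P : RightComodule K M E) (u : Module.Dual K E) : Module.End K M :=
  TensorProduct.rid K M ∘ₗ u.lTensor M ∘ₗ P.coact

theorem dualAct_apply (P : RightComodule K M E) (u : Module.Dual K E) (m : M) :
    P.dualAct u m = TensorProduct.rid K M (u.lTensor M (P.coact m)) := rfl

theorem isSubcomodule_iff (P : RightComodule K M E) (X : Submodule K M) :
    P.IsSubcomodule X ↔ ∀ u, ∀ x ∈ X, P.dualAct u x ∈ X := by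
  simp only [IsSubcomodule, TensorProduct.mem_range_rTensor_iff, dualAct_apply]
  exact ⟨fun h u x hx => h x hx u, fun h x hx u => h u x hx⟩

theorem isArtinian_iff (P : RightComodule K M E) :
    P.IsArtinian ↔
      _root_.IsArtinian (FreeAlgebra K (Module.Dual K E)) (OperatorModule P.dualAct) := by
  rw [OperatorModule.isArtinian_iff, IsArtinian]
  exact wellFoundedLT_subtype_congr P.isSubcomodule_iff

theorem IsHom.dualAct {P : RightComodule K M E} {Q : RightComodule K N E} {f : M →ₗ[K] N}
    (h : P.IsHom Q f) (u : Module.Dual K E) (m : M) : f (P.dualAct u m) = Q.dualAct u (f m) := by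
  have := LinearMap.congr_fun h m
  simp only [LinearMap.comp_apply] at this
  rw [dualAct_apply, dualAct_apply, this]
  generalize P.coact m = t
  induction t with
  | zero => simp
  | add x y hx hy => simp_all
  | tmul v w => simp

/-- The comodule map `m ↦ u(m₍₀₎) m₍₁₎` into `E` given by a functional `u` on `M`. -/
noncomputable def coeff (P : RightComodule K M E) (u : Module.Dual K M) : M →ₗ[K] E :=
  TensorProduct.lid K E ∘ₗ u.rTensor E ∘ₗ P.coact

theorem counit_coeff (P : RightComodule K M E) (u : Module.Dual K M) (m : M) :
    Coalgebra.counit (R := K) (P.coeff u m) = u m := by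
  have h := congrArg (fun t => TensorProduct.rid K K (u.rTensor K t))
    (LinearMap.congr_fun P.counit_coact m)
  simp only [LinearMap.flip_apply, TensorProduct.mk_apply, LinearMap.rTensor_tmul, TensorProduct.rid_tmul, one_smul,
    LinearMap.comp_apply] at h
  rw [← h, coeff, LinearMap.comp_apply, LinearMap.comp_apply, LinearEquiv.coe_coe]
  clear h
  generalize P.coact m = t
  induction t with
  | zero => simp
  | add x y hx hy => simp_all
  | tmul v w => simp [mul_comm]

theorem isHom_coeff (P : RightComodule K M E) (u : Module.Dual K M) :
    P.IsHom (regular K E) (P.coeff u) := by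
  refine LinearMap.ext fun m => ?_
  -- Now `M` is the first leg, so coassociativity is rebracketed before `u` is applied.
  have h := congrArg (fun t => (TensorProduct.lid K E).toLinearMap.rTensor E
    ((u.rTensor E).rTensor E ((TensorProduct.assoc K M E E).symm t))) (LinearMap.congr_fun P.coassoc m)
  simp only [LinearMap.comp_apply, LinearEquiv.coe_coe] at h ⊢
  rw [coeff, LinearMap.rTensor_comp, LinearMap.rTensor_comp]
  simp only [LinearMap.comp_apply, LinearEquiv.coe_coe, regular]
  rw [LinearEquiv.symm_apply_apply] at h
  rw [h]
  clear h
  generalize P.coact m = t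
  induction t with
  | zero => simp
  | add x y hx hy => simp_all
  | tmul v w =>
    simp only [LinearMap.rTensor_tmul, LinearMap.lTensor_tmul, TensorProduct.lid_tmul, map_smul]
    generalize Coalgebra.comul (R := K) w = s
    induction s with
    | zero => simp
    | add x y hx hy => simp_all [TensorProduct.tmul_add]
    | tmul a b => simp [TensorProduct.smul_tmul']

theorem isHom_power_proj (P : RightComodule K M E) (n : ℕ) (j : Fin n) :
    (P.power n).IsHom P (LinearMap.proj j) := by
  refine LinearMap.ext fun m => ?_
  simp only [power, LinearMap.comp_apply, LinearMap.sum_apply, map_sum, LinearMap.proj_apply,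
    ← LinearMap.rTensor_comp_apply]
  rw [Finset.sum_eq_single j]
  · rw [LinearMap.proj_comp_single_same]; simp
  · intro i _ hi
    rw [LinearMap.proj_comp_single_ne _ _ _ _ hi.symm]; simp
  · simp

theorem IsHom.comp {P : RightComodule K M E} {Q : RightComodule K N E} {L : Type*} [AddCommGroup L]
    [Module K L] {R : RightComodule K L E} {g : N →ₗ[K] L} {f : M →ₗ[K] N} (hg : Q.IsHom R g)
    (hf : P.IsHom Q f) : P.IsHom R (g ∘ₗ f) := by
  rw [IsHom] at *
  rw [← LinearMap.comp_assoc, hg, LinearMap.comp_assoc, hf, LinearMap.rTensor_comp,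
    LinearMap.comp_assoc]

theorem isHom_pi {P : RightComodule K M E} {Q : RightComodule K N E} {n : ℕ}
    {f : Fin n → M →ₗ[K] N} (hf : ∀ i, P.IsHom Q (f i)) :
    P.IsHom (Q.power n) (LinearMap.pi f) := by
  have e : LinearMap.pi f
      = ∑ i, LinearMap.single K (fun _ : Fin n => N) i ∘ₗ f i := by
    ext m j
    simp [LinearMap.sum_apply, Pi.single_apply]
  refine LinearMap.ext fun m => ?_
  have h (i : Fin n) := LinearMap.congr_fun (hf i) m
  simp only [LinearMap.comp_apply] at h
  have e' : (LinearMap.pi f).rTensor E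
      = ∑ i, (LinearMap.single K (fun _ : Fin n => N) i ∘ₗ f i).rTensor E := by
    rw [e]
    exact map_sum (LinearMap.rTensorHom E) _ _
  simp only [e', power, LinearMap.sum_apply, LinearMap.comp_apply, LinearMap.proj_apply,
    LinearMap.pi_apply, h, LinearMap.rTensor_comp]

theorem IsArtinian.isFinitelyCogenerated {P : RightComodule K M E} (h : P.IsArtinian) :
    P.IsFinitelyCogenerated := by
  classical
  rw [isArtinian_iff] at h
  obtain ⟨s, hs⟩ := OperatorModule.exists_finset_separating h P.coeff
    (fun u => (P.isHom_coeff u).dualAct) fun m hm => by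
      refine (Module.forall_dual_apply_eq_zero_iff K (V := M) m).1 fun u => ?_
      rw [← P.counit_coeff u, hm, map_zero]
  let e := (insert 0 s).equivFin
  refine ⟨(insert 0 s).card, by simp, LinearMap.pi fun i => P.coeff (e.symm i),
    isHom_pi fun i => P.isHom_coeff _, (injective_iff_map_eq_zero _).2 fun m hm => ?_⟩
  refine hs m fun u hu => ?_
  have := congrFun hm (e ⟨u, Finset.mem_insert_of_mem hu⟩)
  rw [LinearMap.pi_apply, e.symm_apply_apply] at this
  exact this

theorem IsFinitelyCogenerated.isArtinian {P : RightComodule K M E} (h : P.IsFinitelyCogenerated)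
    (hD : IsRightArtinianCoalgebra K E) : P.IsArtinian := by
  obtain ⟨n, -, f, hf, inj⟩ := h
  rw [IsRightArtinianCoalgebra, isArtinian_iff] at hD
  rw [isArtinian_iff]
  exact OperatorModule.isArtinian_of_separating hD _
    (fun i => ((isHom_power_proj _ n i).comp hf).dualAct)
    fun m hm => inj ((funext hm).trans (map_zero f).symm)

end RightComodule

/-! ### The dual action on the triangular comatrix coalgebra -/

namespace TriangularComatrix

variable {K D M E : Type*} [Field K] [AddCommGroup D] [Module K D] [Coalgebra K D]
  [AddCommGroup M] [Module K M] [AddCommGroup E] [Module K E] [Coalgebra K E]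
  (B : Bicomodule K D M E)

/-- The projection `(d m; 0 e) ↦ d`. -/
def prD : TriangularComatrix B →ₗ[K] D := LinearMap.fst K D (M × E)

/-- The projection `(d m; 0 e) ↦ m`. -/
def prM : TriangularComatrix B →ₗ[K] M := LinearMap.fst K M E ∘ₗ LinearMap.snd K D (M × E)

/-- The projection `(d m; 0 e) ↦ e`. -/
def prE : TriangularComatrix B →ₗ[K] E := LinearMap.snd K M E ∘ₗ LinearMap.snd K D (M × E)

@[simp] theorem prD_inD (d : D) : prD B (inD B d) = d := rfl
@[simp] theorem prD_inM (m : M) : prD B (inM B m) = 0 := rfl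
@[simp] theorem prD_inE (e : E) : prD B (inE B e) = 0 := rfl
@[simp] theorem prM_inD (d : D) : prM B (inD B d) = 0 := rfl
@[simp] theorem prM_inM (m : M) : prM B (inM B m) = m := rfl
@[simp] theorem prM_inE (e : E) : prM B (inE B e) = 0 := rfl
@[simp] theorem prE_inD (d : D) : prE B (inD B d) = 0 := rfl
@[simp] theorem prE_inM (m : M) : prE B (inM B m) = 0 := rfl
@[simp] theorem prE_inE (e : E) : prE B (inE B e) = e := rfl

theorem ext_pr {x y : TriangularComatrix B} (h₁ : prD B x = prD B y) (h₂ : prM B x = prM B y)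
    (h₃ : prE B x = prE B y) : x = y :=
  Prod.ext h₁ (Prod.ext h₂ h₃)

/-- Ensures that functionals on the whole coalgebra induce on `D` and on the left comodule `M` every
operator coming from the dual of `D`. -/
theorem dual_comp_inD_surjective : Function.Surjective
    fun u : Module.Dual K (TriangularComatrix B) => (u ∘ₗ inD B : Module.Dual K D) :=
  fun v => ⟨v ∘ₗ prD B, rfl⟩

theorem dual_comp_inE_surjective : Function.Surjective
    fun u : Module.Dual K (TriangularComatrix B) => (u ∘ₗ inE B : Module.Dual K E) :=
  fun v => ⟨v ∘ₗ prE B, rfl⟩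

section

variable {S T V : Type*} [AddCommGroup S] [Module K S] [AddCommGroup T] [Module K T]
  [AddCommGroup V] [Module K V]

theorem lid_rTensor_map (u : Module.Dual K V) (f : S →ₗ[K] V) (g : T →ₗ[K] V) (t : S ⊗[K] T) :
    TensorProduct.lid K V (u.rTensor V (TensorProduct.map f g t))
      = g (TensorProduct.lid K T ((u ∘ₗ f).rTensor T t)) := by
  induction t with
  | zero => simp
  | add x y hx hy => simp_all
  | tmul v w => simp

theorem rid_lTensor_map (u : Module.Dual K V) (f : S →ₗ[K] V) (g : T →ₗ[K] V) (t : S ⊗[K] T) :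
    TensorProduct.rid K V (u.lTensor V (TensorProduct.map f g t))
      = f (TensorProduct.rid K S ((u ∘ₗ g).lTensor S t)) := by
  induction t with
  | zero => simp
  | add x y hx hy => simp_all
  | tmul v w => simp

end

section

variable (u : Module.Dual K (TriangularComatrix B))

theorem left_dualAct_inD (d : D) :
    (LeftComodule.regular K (TriangularComatrix B)).dualAct u (inD B d)
      = inD B ((LeftComodule.regular K D).dualAct (u ∘ₗ inD B) d) := by
  simp only [LeftComodule.dualAct_apply, LeftComodule.regular, comul_inD, lid_rTensor_map]

/-- The coefficient term lies in `E`, so modulo `E` only the left coaction of `M` survives. -/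
theorem left_dualAct_inM (m : M) :
    (LeftComodule.regular K (TriangularComatrix B)).dualAct u (inM B m)
      = inM B (B.left.dualAct (u ∘ₗ inD B) m) + inE B (B.right.coeff (u ∘ₗ inM B) m) := by
  simp only [LeftComodule.dualAct_apply, LeftComodule.regular, comul_inM, map_add, lid_rTensor_map,
    RightComodule.coeff, LinearMap.comp_apply, LinearEquiv.coe_coe]

theorem left_dualAct_inE (e : E) :
    (LeftComodule.regular K (TriangularComatrix B)).dualAct u (inE B e)
      = inE B ((LeftComodule.regular K E).dualAct (u ∘ₗ inE B) e) := by
  simp only [LeftComodule.dualAct_apply, LeftComodule.regular, comul_inE, lid_rTensor_map]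

theorem right_dualAct_inD (d : D) :
    (RightComodule.regular K (TriangularComatrix B)).dualAct u (inD B d)
      = inD B ((RightComodule.regular K D).dualAct (u ∘ₗ inD B) d) := by
  simp only [RightComodule.dualAct_apply, RightComodule.regular, comul_inD, rid_lTensor_map]

/-- Here the extra term lies in `D`, which is why the roles of `D` and `E` are exchanged on the
right. -/
theorem right_dualAct_inM (m : M) :
    (RightComodule.regular K (TriangularComatrix B)).dualAct u (inM B m)
      = inD B (B.left.coeff (u ∘ₗ inM B) m) + inM B (B.right.dualAct (u ∘ₗ inE B) m) := by
  simp only [RightComodule.dualAct_apply, RightComodule.regular, comul_inM, map_add,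
    rid_lTensor_map, LeftComodule.coeff, LinearMap.comp_apply, LinearEquiv.coe_coe]

theorem right_dualAct_inE (e : E) :
    (RightComodule.regular K (TriangularComatrix B)).dualAct u (inE B e)
      = inE B ((RightComodule.regular K E).dualAct (u ∘ₗ inE B) e) := by
  simp only [RightComodule.dualAct_apply, RightComodule.regular, comul_inE, rid_lTensor_map]

theorem prD_left_dualAct (x : TriangularComatrix B) :
    prD B ((LeftComodule.regular K (TriangularComatrix B)).dualAct u x)
      = (LeftComodule.regular K D).dualAct (u ∘ₗ inD B) (prD B x) := by
  suffices prD B ∘ₗ (LeftComodule.regular K (TriangularComatrix B)).dualAct u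
    = (LeftComodule.regular K D).dualAct (u ∘ₗ inD B) ∘ₗ prD B from LinearMap.congr_fun this x
  apply hom_ext B <;> ext y <;>
    simp [left_dualAct_inD, left_dualAct_inM, left_dualAct_inE]

theorem prM_left_dualAct (x : TriangularComatrix B) :
    prM B ((LeftComodule.regular K (TriangularComatrix B)).dualAct u x)
      = B.left.dualAct (u ∘ₗ inD B) (prM B x) := by
  suffices prM B ∘ₗ (LeftComodule.regular K (TriangularComatrix B)).dualAct u
    = B.left.dualAct (u ∘ₗ inD B) ∘ₗ prM B from LinearMap.congr_fun this x
  apply hom_ext B <;> ext y <;>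
    simp [left_dualAct_inD, left_dualAct_inM, left_dualAct_inE]

theorem prM_right_dualAct (x : TriangularComatrix B) :
    prM B ((RightComodule.regular K (TriangularComatrix B)).dualAct u x)
      = B.right.dualAct (u ∘ₗ inE B) (prM B x) := by
  suffices prM B ∘ₗ (RightComodule.regular K (TriangularComatrix B)).dualAct u
    = B.right.dualAct (u ∘ₗ inE B) ∘ₗ prM B from LinearMap.congr_fun this x
  apply hom_ext B <;> ext y <;>
    simp [right_dualAct_inD, right_dualAct_inM, right_dualAct_inE]

theorem prE_right_dualAct (x : TriangularComatrix B) :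
    prE B ((RightComodule.regular K (TriangularComatrix B)).dualAct u x)
      = (RightComodule.regular K E).dualAct (u ∘ₗ inE B) (prE B x) := by
  suffices prE B ∘ₗ (RightComodule.regular K (TriangularComatrix B)).dualAct u
    = (RightComodule.regular K E).dualAct (u ∘ₗ inE B) ∘ₗ prE B from LinearMap.congr_fun this x
  apply hom_ext B <;> ext y <;>
    simp [right_dualAct_inD, right_dualAct_inM, right_dualAct_inE]

end

theorem isLeftArtinian_iff : IsLeftArtinianCoalgebra K (TriangularComatrix B) ↔
    IsLeftArtinianCoalgebra K D ∧ IsLeftArtinianCoalgebra K E ∧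
      B.left.IsFinitelyCogenerated := by
  have key : IsLeftArtinianCoalgebra K (TriangularComatrix B) ↔
      IsLeftArtinianCoalgebra K E ∧ IsLeftArtinianCoalgebra K D ∧ B.left.IsArtinian := by
    simp only [IsLeftArtinianCoalgebra, LeftComodule.isArtinian_iff]
    -- Put `D`, `M` and `E` over the free algebra on the dual of the whole coalgebra, so that they
    -- fit in one exact sequence.
    rw [← OperatorModule.isArtinian_comp_iff _ (dual_comp_inD_surjective B),
      ← OperatorModule.isArtinian_comp_iff _ (dual_comp_inD_surjective B),
      ← OperatorModule.isArtinian_comp_iff _ (dual_comp_inE_surjective B)]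
    exact OperatorModule.isArtinian_iff_of_exact (inE B) (prD B) (prM B)
      (fun u e => (left_dualAct_inE B u e).symm) (prD_left_dualAct B) (prM_left_dualAct B)
      (Function.LeftInverse.injective (prE_inE B)) (Function.RightInverse.surjective (prD_inD B))
      (Function.RightInverse.surjective (prM_inM B))
      (fun x h₁ h₂ => ⟨prE B x, ext_pr B h₁.symm h₂.symm rfl⟩) (prD_inE B) (prM_inE B)
  rw [key]
  exact ⟨fun ⟨hE, hD, hM⟩ => ⟨hD, hE, hM.isFinitelyCogenerated⟩,
    fun ⟨hD, hE, hM⟩ => ⟨hE, hD, hM.isArtinian hD⟩⟩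

theorem isRightArtinian_iff : IsRightArtinianCoalgebra K (TriangularComatrix B) ↔
    IsRightArtinianCoalgebra K D ∧ IsRightArtinianCoalgebra K E ∧
      B.right.IsFinitelyCogenerated := by
  have key : IsRightArtinianCoalgebra K (TriangularComatrix B) ↔
      IsRightArtinianCoalgebra K D ∧ B.right.IsArtinian ∧ IsRightArtinianCoalgebra K E := by
    simp only [IsRightArtinianCoalgebra, RightComodule.isArtinian_iff]
    rw [← OperatorModule.isArtinian_comp_iff _ (dual_comp_inD_surjective B),
      ← OperatorModule.isArtinian_comp_iff _ (dual_comp_inE_surjective B),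
      ← OperatorModule.isArtinian_comp_iff _ (dual_comp_inE_surjective B)]
    exact OperatorModule.isArtinian_iff_of_exact (inD B) (prM B) (prE B)
      (fun u d => (right_dualAct_inD B u d).symm) (prM_right_dualAct B) (prE_right_dualAct B)
      (Function.LeftInverse.injective (prD_inD B)) (Function.RightInverse.surjective (prM_inM B))
      (Function.RightInverse.surjective (prE_inE B))
      (fun x h₁ h₂ => ⟨prD B x, ext_pr B rfl h₁.symm h₂.symm⟩) (prM_inD B) (prE_inD B)
  rw [key]
  exact ⟨fun ⟨hD, hM, hE⟩ => ⟨hD, hE, hM.isFinitelyCogenerated⟩,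
    fun ⟨hD, hE, hM⟩ => ⟨hD, hM.isArtinian hE, hE⟩⟩

end TriangularComatrix

/-! ### The coalgebra `(D D; 0 K)` -/

section

variable {K D : Type*} [Field K] [AddCommGroup D] [Module K D] [Coalgebra K D]

theorem LeftComodule.isFinitelyCogenerated_regular :
    (LeftComodule.regular K D).IsFinitelyCogenerated :=
  ⟨1, one_pos, LinearMap.pi fun _ => LinearMap.id,
    isHom_pi fun _ => by rw [IsHom, LinearMap.lTensor_id]; rfl,
    fun _ _ h => congrFun h 0⟩

theorem isLeftArtinianCoalgebra_triangular_regular (hD : IsLeftArtinianCoalgebra K D) :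
    IsLeftArtinianCoalgebra K (TriangularComatrix (LeftComodule.regular K D).toBicomodule) :=
  (TriangularComatrix.isLeftArtinian_iff _).2
    ⟨hD, LeftComodule.isArtinian_of_finiteDimensional _,
      LeftComodule.isFinitelyCogenerated_regular⟩

/-- Finite cogeneration over `K` would embed `D` linearly in some `Kⁿ`. -/
theorem not_isRightArtinianCoalgebra_triangular_regular (hD : ¬ FiniteDimensional K D) :
    ¬ IsRightArtinianCoalgebra K
      (TriangularComatrix (LeftComodule.regular K D).toBicomodule) := by
  rw [TriangularComatrix.isRightArtinian_iff]
  rintro ⟨-, -, n, -, f, -, inj⟩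
  exact hD (FiniteDimensional.of_injective f inj)

end

/-! ### The divided power coalgebra -/

namespace DividedPowerCoalgebra

variable (K : Type*) [Field K]

theorem not_finiteDimensional : ¬ FiniteDimensional K (DividedPowerCoalgebra K) := fun _ =>
  not_finite_iff_infinite.2 (inferInstanceAs (Infinite ℕ)) (Module.Finite.finite_basis (basis K))

theorem left_dualAct_coord (k n : ℕ) :
    (LeftComodule.regular K (DividedPowerCoalgebra K)).dualAct ((basis K).coord k) (basis K n)
      = if k ≤ n then basis K (n - k) else 0 := by
  simp only [LeftComodule.dualAct_apply, LeftComodule.regular, comul_basis, map_sum,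
    LinearMap.rTensor_tmul, TensorProduct.lid_tmul, Module.Basis.coord_apply,
    Module.Basis.repr_self, Finsupp.single_apply, ite_smul, one_smul, zero_smul]
  split_ifs with h
  · rw [Finset.sum_eq_single (k, n - k)]
    · simp
    · rintro ⟨a, b⟩ hab hne
      rw [if_neg]
      rintro rfl
      rw [Finset.HasAntidiagonal.mem_antidiagonal] at hab
      exact hne (Prod.ext rfl (by simp only at hab ⊢; omega))
    · intro hk
      exact absurd (Finset.HasAntidiagonal.mem_antidiagonal.2 (by simp only; omega)) hk
  · refine Finset.sum_eq_zero fun p hp => if_neg ?_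
    rw [Finset.HasAntidiagonal.mem_antidiagonal] at hp
    omega

/-- Cocommutativity: swapping the two indices permutes the antidiagonal. -/
theorem right_dualAct_eq_left (u : Module.Dual K (DividedPowerCoalgebra K)) :
    (RightComodule.regular K (DividedPowerCoalgebra K)).dualAct u
      = (LeftComodule.regular K (DividedPowerCoalgebra K)).dualAct u := by
  refine (basis K).ext fun n => ?_
  simp only [LeftComodule.dualAct_apply, RightComodule.dualAct_apply, LeftComodule.regular,
    RightComodule.regular, comul_basis, map_sum, LinearMap.rTensor_tmul, LinearMap.lTensor_tmul,
    TensorProduct.lid_tmul, TensorProduct.rid_tmul]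
  exact Finset.sum_nbij' Prod.swap Prod.swap (by simp [add_comm]) (by simp [add_comm])
    (by simp) (by simp) (by simp)

variable {K}

theorem left_dualAct_coord_eq_sum (k : ℕ) (x : DividedPowerCoalgebra K) {n : ℕ}
    (hn : ∀ i, n < i → (basis K).repr x i = 0) (hk : k ≤ n) :
    (LeftComodule.regular K (DividedPowerCoalgebra K)).dualAct ((basis K).coord k) x
      = ∑ j ∈ Finset.range (n - k + 1), (basis K).repr x (j + k) • basis K j := by
  have hx : x = ∑ i ∈ Finset.range (n + 1), (basis K).repr x i • basis K i := by
    conv_lhs => rw [← (basis K).linearCombination_repr x, Finsupp.linearCombination_apply]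
    refine Finsupp.sum_of_support_subset _ (fun i hi => ?_) _ (by simp)
    rw [Finset.mem_range]
    by_contra h
    exact Finsupp.mem_support_iff.1 hi (hn i (by omega))
  conv_lhs => rw [hx]
  -- The first `k` terms are killed by the shift; the others move down by `k`.
  rw [map_sum, show n + 1 = k + (n - k + 1) by omega, Finset.sum_range_add, Finset.sum_eq_zero,
    zero_add]
  · refine Finset.sum_congr rfl fun j _ => ?_
    rw [map_smul, left_dualAct_coord, if_pos (Nat.le_add_right k j), Nat.add_sub_cancel_left,
      add_comm]
  · intro i hi
    rw [map_smul, left_dualAct_coord, if_neg (by simpa using hi), smul_zero]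

/-- An invariant subspace that contains an element of degree `n` contains `c₀, …, cₙ`. -/
theorem basis_mem_of_degree {X : Submodule K (DividedPowerCoalgebra K)}
    (hX : ∀ u, ∀ x ∈ X, (LeftComodule.regular K (DividedPowerCoalgebra K)).dualAct u x ∈ X)
    {x : DividedPowerCoalgebra K} (hx : x ∈ X) {n : ℕ} (h₀ : (basis K).repr x n ≠ 0)
    (hn : ∀ i, n < i → (basis K).repr x i = 0) (m : ℕ) (hm : m ≤ n) : basis K m ∈ X := by
  induction m using Nat.strong_induction_on with
  | _ m ih =>
    -- Shifting down by `n - m` turns the leading term of `x` into a nonzero multiple of `c_m`; the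
    -- lower terms are in `X` by induction.
    have h := hX ((basis K).coord (n - m)) x hx
    rw [left_dualAct_coord_eq_sum _ x hn (Nat.sub_le n m), Nat.sub_sub_self hm,
      Finset.sum_range_succ, Nat.add_sub_cancel' hm] at h
    have hs : ∑ j ∈ Finset.range m, (basis K).repr x (j + (n - m)) • basis K j ∈ X :=
      X.sum_mem fun j hj => by
        have := Finset.mem_range.1 hj
        exact X.smul_mem _ (ih j this (by omega))
    exact (X.smul_mem_iff h₀).1 ((X.add_mem_iff_right hs).1 h)

/-- Proper invariant subspaces are finite dimensional. -/
theorem finiteDimensional_of_ne_top {X : Submodule K (DividedPowerCoalgebra K)}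
    (hX : ∀ u, ∀ x ∈ X, (LeftComodule.regular K (DividedPowerCoalgebra K)).dualAct u x ∈ X)
    (h : X ≠ ⊤) : FiniteDimensional K X := by
  obtain ⟨N, hN⟩ : ∃ N, basis K N ∉ X := by
    by_contra! hc
    exact h (top_unique ((basis K).span_eq.ge.trans
      (Submodule.span_le.2 (Set.range_subset_iff.2 hc))))
  -- An element of degree at least `N` would force `c_N` into `X`.
  have hle : X ≤ Submodule.span K (basis K '' (Finset.range N : Set ℕ)) := by
    intro x hx
    rw [(basis K).mem_span_image]
    intro i hi
    have hne : ((basis K).repr x).support.Nonempty := ⟨i, hi⟩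
    have hmax := ((basis K).repr x).support.le_max' i hi
    have hlt : ((basis K).repr x).support.max' hne < N := by
      by_contra hc
      refine hN (basis_mem_of_degree hX hx
        (Finsupp.mem_support_iff.1 (Finset.max'_mem _ hne)) (fun j hj => ?_) N (not_lt.1 hc))
      by_contra hj'
      exact absurd (Finset.le_max' _ j (Finsupp.mem_support_iff.2 hj')) (not_le.2 hj)
    exact Finset.mem_coe.2 (Finset.mem_range.2 (hmax.trans_lt hlt))
  have : FiniteDimensional K (Submodule.span K (basis K '' (Finset.range N : Set ℕ))) :=
    FiniteDimensional.span_of_finite K ((Finset.finite_toSet _).image _)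
  exact Submodule.finiteDimensional_of_le hle

variable (K)

theorem isLeftArtinian : IsLeftArtinianCoalgebra K (DividedPowerCoalgebra K) := by
  rw [IsLeftArtinianCoalgebra, LeftComodule.IsArtinian,
    wellFoundedLT_subtype_congr (LeftComodule.isSubcomodule_iff _)]
  -- Below a proper subcomodule the dimension is finite and drops strictly. The whole space is
  -- handled afterwards: anything strictly below it is proper.
  have acc (d : ℕ) : ∀ X : {X : Submodule K (DividedPowerCoalgebra K) // ∀ u, ∀ x ∈ X,
      (LeftComodule.regular K (DividedPowerCoalgebra K)).dualAct u x ∈ X},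
      X.1 ≠ ⊤ → Module.finrank K X.1 = d → Acc (· < ·) X := by
    induction d using Nat.strong_induction_on with
    | _ d ih =>
      intro X hX hd
      refine Acc.intro _ fun Y hY => ?_
      have hY' : Y.1 < X.1 := hY
      have := finiteDimensional_of_ne_top X.2 hX
      exact ih _ (hd ▸ Submodule.finrank_lt_finrank_of_lt hY') Y (hY'.trans_le le_top).ne rfl
  refine ⟨⟨fun X => Acc.intro _ fun Y hY => ?_⟩⟩
  have hY' : Y.1 < X.1 := hY
  exact acc _ Y (hY'.trans_le le_top).ne rfl

theorem isRightArtinian : IsRightArtinianCoalgebra K (DividedPowerCoalgebra K) := by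
  refine (wellFoundedLT_subtype_congr fun X => ?_).1 (isLeftArtinian K)
  rw [LeftComodule.isSubcomodule_iff, RightComodule.isSubcomodule_iff]
  simp only [right_dualAct_eq_left]

end DividedPowerCoalgebra

theorem mainTheorem8 {K : Type*} [Field K] :
    -- the criterion for `(D M; 0 E)`, left and right
    (∀ {D : Type*} {M : Type*} {E : Type*} [AddCommGroup D] [Module K D] [Coalgebra K D]
      [AddCommGroup M] [Module K M] [AddCommGroup E] [Module K E] [Coalgebra K E]
      (B : Bicomodule K D M E),
      (IsLeftArtinianCoalgebra K (TriangularComatrix B) ↔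
        IsLeftArtinianCoalgebra K D ∧ IsLeftArtinianCoalgebra K E ∧
          B.left.IsFinitelyCogenerated) ∧
      (IsRightArtinianCoalgebra K (TriangularComatrix B) ↔
        IsRightArtinianCoalgebra K D ∧ IsRightArtinianCoalgebra K E ∧
          B.right.IsFinitelyCogenerated)) ∧
    -- `(D D; 0 K)` is left but not right Artinian if `D` is infinite dimensional and left Artinian
    (∀ {D : Type*} [AddCommGroup D] [Module K D] [Coalgebra K D],
      ¬ FiniteDimensional K D → IsLeftArtinianCoalgebra K D →
        IsLeftArtinianCoalgebra K
          (TriangularComatrix (LeftComodule.regular K D).toBicomodule) ∧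
        ¬ IsRightArtinianCoalgebra K
          (TriangularComatrix (LeftComodule.regular K D).toBicomodule)) ∧
    -- the divided power coalgebra is such a coalgebra `D`
    (¬ FiniteDimensional K (DividedPowerCoalgebra K) ∧
      IsLeftArtinianCoalgebra K (DividedPowerCoalgebra K) ∧
      IsRightArtinianCoalgebra K (DividedPowerCoalgebra K)) ∧
    -- hence a left but not right Artinian coalgebra exists over every field
    (IsLeftArtinianCoalgebra K (TriangularComatrix
        (LeftComodule.regular K (DividedPowerCoalgebra K)).toBicomodule) ∧
      ¬ IsRightArtinianCoalgebra K (TriangularComatrix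
        (LeftComodule.regular K (DividedPowerCoalgebra K)).toBicomodule)) :=
  ⟨fun B => ⟨TriangularComatrix.isLeftArtinian_iff B, TriangularComatrix.isRightArtinian_iff B⟩,
    fun hD hA => ⟨isLeftArtinianCoalgebra_triangular_regular hA,
      not_isRightArtinianCoalgebra_triangular_regular hD⟩,
    ⟨DividedPowerCoalgebra.not_finiteDimensional K, DividedPowerCoalgebra.isLeftArtinian K,
      DividedPowerCoalgebra.isRightArtinian K⟩,
    isLeftArtinianCoalgebra_triangular_regular (DividedPowerCoalgebra.isLeftArtinian K),
    not_isRightArtinianCoalgebra_triangular_regular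
      (DividedPowerCoalgebra.not_finiteDimensional K)⟩
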